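/- Let $p$ be fixed, $\beta^*\in\mathbf{R}^p$, and let $Y_i = X_i^\top\beta^* + \xi_i$, $i\ge 1$ (no contamination), where the pairs $(X_i,\xi_i)$ are i.i.d., $\xi_i$ is independent of $X_i$, the covariates $X_i\in\mathbf{R}^p$ are centered, isotropic ($\mathbf{E}[X_1X_1^\top]=\mathrm{I}_p$) and $1$-sub-Gaussian ($\mathbf{E}\exp\langle u,X_1\rangle\le \exp(\|u\|^2/2)$ for all $u\in\mathbf{R}^p$), and the noise satisfies $\mathbf{E}\,\xi_1=0$, $\mathbf{E}\,\xi_1^2=1$. Let $\tau_n=u_n/n$, where $u_n\to\infty$ slowly, in the sense that $u_n\to\infty$ and $u_n/n\to 0$, and let $$f_n(\beta)=\frac1n\sum_{i=1}^n\frac1{\tau_n}\Big(1-\exp\Big(-\frac{\tau_n (Y_i-X_i^\top\beta)^2}{2}\Big)\Big)$$ be the Welsch objective. Consider the following algorithm, with inputs $(X_1,Y_1),\dots,(X_n,Y_n)$, $\tau_n$, a fixed threshold $c\in\mathbf{R}$ and a fixed starting point $\beta_0\in\mathbf{R}^p$. (1) As long as the current iterate $\beta_k$ satisfies $\mathrm{median}\big((|Y_i-X_i^\top\beta_k|)_{i\le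 n}\big)\ge c$, make one descent step for the least absolute deviation objective, that is, pass to some $\beta_{k+1}$ with $\sum_{i=1}^n|Y_i-X_i^\top\beta_{k+1}|\le\sum_{i=1}^n|Y_i-X_i^\top\beta_k|$; call $\beta_{\mathrm{LAD}}$ the first iterate at which the median is smaller than $c$. (2) Return a solution of $\min_\beta f_n(\beta)$ computed from the initialization $\beta_{\mathrm{LAD}}$: a point $\hat\beta$ with $\nabla f_n(\hat\beta)=0$ and $f_n(\hat\beta)\le f_n(\beta_{\mathrm{LAD}})$ (for example, any global minimizer of $f_n$). Let $\hat\beta_n$ be random vectors such that, with probability tending to $1$ as $n\to\infty$, the loop (1) terminates and $\hat\beta_n$ is an output of the algorithm on the first $n$ observations. Then $$\sqrt n\,(\hat\beta_n-\beta^*)\xrightarrow{d}\mathcal N(0,\mathrm I_p).$$ -/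

import Mathlib

open MeasureTheory ProbabilityTheory Filter Topology

noncomputable section

namespace WelschRegression

/-- The residuals `Y_i - X_iᵀ b`, `i = 1, …, n`, of a linear model fitted with the vector `b`. -/
def residual {n p : ℕ} (x : Fin n → EuclideanSpace ℝ (Fin p)) (y : Fin n → ℝ)
    (b : EuclideanSpace ℝ (Fin p)) (i : Fin n) : ℝ :=
  y i - inner ℝ (x i) b

/-- The Welsch objective
`b ↦ (1/n) ∑ i, (1/τ) (1 - exp (-τ (Y_i - X_iᵀ b)² / 2))`. -/
def welschObjective {n p : ℕ} (x : Fin n → EuclideanSpace ℝ (Fin p)) (y : Fin n → ℝ) (τ : ℝ)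
    (b : EuclideanSpace ℝ (Fin p)) : ℝ :=
  (1 / (n : ℝ)) * ∑ i, (1 / τ) * (1 - Real.exp (-(τ * residual x y b i ^ 2) / 2))

/-- The least absolute deviation (LAD) objective `b ↦ ∑ i, |Y_i - X_iᵀ b|`. -/
def ladObjective {n p : ℕ} (x : Fin n → EuclideanSpace ℝ (Fin p)) (y : Fin n → ℝ)
    (b : EuclideanSpace ℝ (Fin p)) : ℝ :=
  ∑ i, |residual x y b i|

/-- The median of finitely many real numbers `a_1, …, a_n` (`n ≥ 1`): the mean of the two middle
entries of the increasing rearrangement (which are the same entry when `n` is odd). -/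
def median {n : ℕ} (a : Fin n → ℝ) : ℝ :=
  (((List.ofFn a).insertionSort (· ≤ ·)).getD ((n - 1) / 2) 0 +
    ((List.ofFn a).insertionSort (· ≤ ·)).getD (n / 2) 0) / 2

/-- The median of the absolute residuals at `b`. -/
def medianAbsResidual {n p : ℕ} (x : Fin n → EuclideanSpace ℝ (Fin p)) (y : Fin n → ℝ)
    (b : EuclideanSpace ℝ (Fin p)) : ℝ :=
  median fun i => |residual x y b i|

/-- First stage (the `while` loop). `bLAD` can be returned by the loop started at `b0`: there are
iterates `b 0 = b0, b 1, …, b K = bLAD` such that, as long as the median absolute residual of the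
current iterate is at least `c`, one step of a descent method for the LAD objective is made from
it, and `K` is the first index at which the median absolute residual is below `c`. -/
def IsFirstStageOutput {n p : ℕ} (x : Fin n → EuclideanSpace ℝ (Fin p)) (y : Fin n → ℝ)
    (c : ℝ) (b0 bLAD : EuclideanSpace ℝ (Fin p)) : Prop :=
  ∃ (K : ℕ) (b : ℕ → EuclideanSpace ℝ (Fin p)), b 0 = b0 ∧
    (∀ k < K, c ≤ medianAbsResidual x y (b k) ∧
      ladObjective x y (b (k + 1)) ≤ ladObjective x y (b k)) ∧
    medianAbsResidual x y (b K) < c ∧ b K = bLAD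

/-- Second stage. `bhat` can be returned by a minimization procedure for the Welsch objective
initialized at `bLAD`: it satisfies the first-order condition, and its objective value does not
exceed the one of the initialization. In particular every global minimizer of the Welsch objective
qualifies, whatever `bLAD` is. -/
def IsSecondStageOutput {n p : ℕ} (x : Fin n → EuclideanSpace ℝ (Fin p)) (y : Fin n → ℝ)
    (τ : ℝ) (bLAD bhat : EuclideanSpace ℝ (Fin p)) : Prop :=
  fderiv ℝ (welschObjective x y τ) bhat = 0 ∧
    welschObjective x y τ bhat ≤ welschObjective x y τ bLAD

/-- `bhat` is an output of the two-stage algorithm on the data `(x, y)` with parameters `τ`, `c`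
and starting point `b0`; in particular the first stage terminates. -/
def IsAlgorithmOutput {n p : ℕ} (x : Fin n → EuclideanSpace ℝ (Fin p)) (y : Fin n → ℝ)
    (τ c : ℝ) (b0 bhat : EuclideanSpace ℝ (Fin p)) : Prop :=
  ∃ bLAD, IsFirstStageOutput x y c b0 bLAD ∧ IsSecondStageOutput x y τ bLAD bhat

/-- A random vector is isotropic: `E (X Xᵀ)` is the identity matrix. -/
def IsIsotropic {Ω : Type*} [MeasurableSpace Ω] (μ : Measure Ω) {p : ℕ}
    (X : Ω → EuclideanSpace ℝ (Fin p)) : Prop :=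
  ∀ j k : Fin p, Integrable (fun ω => X ω j * X ω k) μ ∧
    ∫ ω, X ω j * X ω k ∂μ = if j = k then 1 else 0

/-- A random vector is `1`-sub-Gaussian: `E exp ⟨u, X⟩ ≤ exp (‖u‖² / 2)` for all `u`. -/
def IsOneSubGaussian {Ω : Type*} [MeasurableSpace Ω] (μ : Measure Ω) {p : ℕ}
    (X : Ω → EuclideanSpace ℝ (Fin p)) : Prop :=
  ∀ u : EuclideanSpace ℝ (Fin p), Integrable (fun ω => Real.exp (inner ℝ u (X ω))) μ ∧
    ∫ ω, Real.exp (inner ℝ u (X ω)) ∂μ ≤ Real.exp (‖u‖ ^ 2 / 2)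

end WelschRegression

end

noncomputable section

namespace WelschRegression

/-! Write `h = b - β*` and let ψ_τ be `score τ`. A critical point solves ∑ ψ_τ(ξ_i - ⟨X_i, h⟩) X_i =
0, and ψ_τ is close to the identity when τ is small. Linearizing, and replacing the empirical
covariance by the identity, gives n h = ∑ ψ_τ(ξ_i) X_i up to an error n ε ‖h‖
(`exists_forall_isAlgorithmOutput_norm_le`). The error is relative to ‖h‖, so consistency need not
be known beforehand; it is enough that h stays in a fixed ball.

The algorithm supplies that ball. The LAD objective does not increase and grows linearly in ‖h‖, so
the first stage ends at a bounded distance from β*. There the Welsch objective is bounded uniformly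
in τ, and the second stage does not increase it. Finally, a Welsch sublevel set is bounded once τ is
small: a saturated residual costs about 1/τ, so few residuals can be saturated, and the others are
controlled by their loss.

All this is deterministic on the event `IsTypical`, whose probability tends to one by the law of
large numbers. The sum (1/√n) ∑ (ψ_τ(ξ_i) - ξ_i) X_i is centered, because X is centered and
independent of ξ, and its second moment tends to zero; so no rate is needed for τ → 0. What is left
is (1/√n) ∑ ξ_i X_i, and the central limit theorem and Slutsky's lemma conclude. -/

/-- A common envelope of all the moments of a covariate and a noise variable that are needed. -/
def envelope {E : Type*} [Norm E] (x : E) (s : ℝ) : ℝ := (1 + ‖x‖ ^ 4) * (1 + s ^ 2)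

/-! ### Moments dominated by the envelope -/

section Envelope

variable {E : Type*} [NormedAddCommGroup E] (x : E) (s : ℝ)

lemma one_le_envelope : 1 ≤ envelope x s := by
  unfold envelope
  nlinarith [sq_nonneg s, pow_nonneg (norm_nonneg x) 4,
    mul_nonneg (pow_nonneg (norm_nonneg x) 4) (sq_nonneg s)]

lemma norm_pow_four_le_envelope : ‖x‖ ^ 4 ≤ envelope x s := by
  unfold envelope
  nlinarith [sq_nonneg s, mul_nonneg (pow_nonneg (norm_nonneg x) 4) (sq_nonneg s)]

lemma sq_le_envelope : s ^ 2 ≤ envelope x s := by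
  unfold envelope
  nlinarith [pow_nonneg (norm_nonneg x) 4,
    mul_nonneg (pow_nonneg (norm_nonneg x) 4) (sq_nonneg s)]

lemma norm_sq_le_envelope : ‖x‖ ^ 2 ≤ envelope x s := by
  unfold envelope
  nlinarith [sq_nonneg s, mul_nonneg (pow_nonneg (norm_nonneg x) 4) (sq_nonneg s),
    sq_nonneg (‖x‖ ^ 2 - 1)]

lemma norm_le_envelope : ‖x‖ ≤ envelope x s := by
  by_cases h : ‖x‖ ≤ 1
  · exact h.trans (one_le_envelope x s)
  · refine le_trans ?_ (norm_sq_le_envelope x s)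
    nlinarith

lemma abs_le_envelope : |s| ≤ envelope x s := by
  by_cases h : |s| ≤ 1
  · exact h.trans (one_le_envelope x s)
  · refine le_trans ?_ (sq_le_envelope x s)
    rw [← sq_abs]
    nlinarith

lemma norm_sq_mul_sq_le_envelope : ‖x‖ ^ 2 * s ^ 2 ≤ envelope x s := by
  unfold envelope
  nlinarith [sq_nonneg s, mul_nonneg (sq_nonneg (‖x‖ ^ 2 - 1)) (sq_nonneg s),
    mul_nonneg (sq_nonneg (‖x‖ ^ 2 + 1)) (sq_nonneg s), pow_nonneg (norm_nonneg x) 4]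

end Envelope

/-- The data behave like typical data: the envelope has average at most `B`, and the empirical
covariance of the covariates is `η`-close to the identity. -/
structure IsTypical {n p : ℕ} (x : Fin n → EuclideanSpace ℝ (Fin p)) (ξ : Fin n → ℝ)
    (B η : ℝ) : Prop where
  envelope_le : ∑ i, envelope (x i) (ξ i) ≤ n * B
  covariance_le : ∀ h : EuclideanSpace ℝ (Fin p),
    ‖∑ i, (inner ℝ (x i) h : ℝ) • x i - (n : ℝ) • h‖ ≤ n * η * ‖h‖

/-- The score function of the Welsch loss. -/
def score (τ s : ℝ) : ℝ := s * Real.exp (-(τ * s ^ 2) / 2)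

/-! ### Deterministic analysis on typical data -/

section Deterministic

variable {n p : ℕ} {x : Fin n → EuclideanSpace ℝ (Fin p)} {ξ y : Fin n → ℝ} {B η τ : ℝ}
  {βs : EuclideanSpace ℝ (Fin p)}

lemma IsTypical.sum_le (H : IsTypical x ξ B η) {f : Fin n → ℝ}
    (hf : ∀ i, f i ≤ envelope (x i) (ξ i)) : ∑ i, f i ≤ n * B :=
  (Finset.sum_le_sum fun i _ => hf i).trans H.envelope_le

lemma IsTypical.le_sum_inner_sq (H : IsTypical x ξ B η) (hη : η ≤ 1 / 2)
    (h : EuclideanSpace ℝ (Fin p)) :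
    n * (‖h‖ ^ 2 / 2) ≤ ∑ i, (inner ℝ (x i) h : ℝ) ^ 2 := by
  have h1 : (inner ℝ (∑ i, (inner ℝ (x i) h : ℝ) • x i - (n : ℝ) • h) h : ℝ)
      = ∑ i, (inner ℝ (x i) h : ℝ) ^ 2 - n * ‖h‖ ^ 2 := by
    rw [inner_sub_left, sum_inner, real_inner_smul_left, real_inner_self_eq_norm_sq]
    simp only [real_inner_smul_left, sq]
  have h2 := (abs_le.mp (abs_real_inner_le_norm
    (∑ i, (inner ℝ (x i) h : ℝ) • x i - (n : ℝ) • h) h)).1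
  have h3 := mul_le_mul_of_nonneg_right (H.covariance_le h) (norm_nonneg h)
  have h4 : n * η * ‖h‖ * ‖h‖ ≤ n * (1 / 2) * ‖h‖ * ‖h‖ := by gcongr
  rw [h1] at h2
  nlinarith

/-- A lower bound on the second moment and an upper bound on the fourth force a lower bound on the
first, as in the Paley–Zygmund argument. -/
lemma IsTypical.le_sum_abs_inner (H : IsTypical x ξ B η) (hB : 1 ≤ B) (hη : η ≤ 1 / 2)
    (h : EuclideanSpace ℝ (Fin p)) :
    n * (‖h‖ / (8 * B)) ≤ ∑ i, |(inner ℝ (x i) h : ℝ)| := by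
  rcases eq_or_ne h 0 with rfl | h0
  · simp
  have ht : 0 < ‖h‖ := norm_pos_iff.mpr h0
  set t := ‖h‖
  -- Truncation at level 2Bt: below it a² ≤ 2Bt·a, above it 4(Bt)²a² ≤ a⁴, and a⁴ ≤ t⁴‖x i‖⁴ by
  -- Cauchy–Schwarz.
  have hpt : ∀ i, (4 * B ^ 2 * t ^ 2) * (inner ℝ (x i) h : ℝ) ^ 2 - t ^ 4 * ‖x i‖ ^ 4
      ≤ (8 * B ^ 3 * t ^ 3) * |(inner ℝ (x i) h : ℝ)| := by
    intro i
    have hcs : |(inner ℝ (x i) h : ℝ)| ≤ ‖x i‖ * t := abs_real_inner_le_norm _ _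
    have h4 := pow_le_pow_left₀ (abs_nonneg _) hcs 4
    rw [← sq_abs (inner ℝ (x i) h : ℝ)]
    set a := |(inner ℝ (x i) h : ℝ)|
    have ha : 0 ≤ a := abs_nonneg _
    have hBt : 0 < B * t := by positivity
    have key : a * (4 * (B * t) ^ 2 * a - a ^ 3) ≤ a * (8 * (B * t) ^ 3) := by
      refine mul_le_mul_of_nonneg_left ?_ ha
      by_cases hc : a ≤ 2 * (B * t)
      · nlinarith [pow_nonneg ha 3, mul_le_mul_of_nonneg_left hc (sq_nonneg (B * t))]
      · push Not at hc
        have h5 : 4 * (B * t) ^ 2 ≤ a ^ 2 := by nlinarith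
        nlinarith [pow_pos hBt 3, mul_le_mul_of_nonneg_right h5 ha]
    nlinarith
  have hs := Finset.sum_le_sum fun i (_ : i ∈ Finset.univ) => hpt i
  rw [Finset.sum_sub_distrib, ← Finset.mul_sum, ← Finset.mul_sum, ← Finset.mul_sum] at hs
  have h2 := H.le_sum_inner_sq hη h
  have h4 := H.sum_le fun i => norm_pow_four_le_envelope (x i) (ξ i)
  have h2' := mul_le_mul_of_nonneg_left h2 (by positivity : 0 ≤ 4 * B ^ 2 * t ^ 2)
  have h4' := mul_le_mul_of_nonneg_left h4 (by positivity : 0 ≤ t ^ 4)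
  have hn : (0 : ℝ) ≤ n := by positivity
  have hBB : (n : ℝ) * t ^ 4 * B ≤ n * t ^ 4 * B ^ 2 := by
    refine mul_le_mul_of_nonneg_left ?_ (by positivity)
    nlinarith
  have hfin : (8 * B ^ 3 * t ^ 3) * (n * (t / (8 * B))) = n * t ^ 4 * B ^ 2 := by
    field_simp
  have hpos : 0 < 8 * B ^ 3 * t ^ 3 := by positivity
  refine le_of_mul_le_mul_left ?_ hpos
  rw [hfin]
  linarith

/-! ### A priori bounds: both stages stay in a fixed ball -/

lemma residual_eq (hy : ∀ i, y i = inner ℝ (x i) βs + ξ i) (b : EuclideanSpace ℝ (Fin p))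
    (i : Fin n) : residual x y b i = ξ i - inner ℝ (x i) (b - βs) := by
  rw [residual, hy, inner_sub_right]
  ring

lemma IsFirstStageOutput.ladObjective_le {c : ℝ} {b0 bL : EuclideanSpace ℝ (Fin p)}
    (h : IsFirstStageOutput x y c b0 bL) : ladObjective x y bL ≤ ladObjective x y b0 := by
  obtain ⟨K, b, h0, hstep, -, hK⟩ := h
  have : ∀ k ≤ K, ladObjective x y (b k) ≤ ladObjective x y b0 := by
    intro k
    induction k with
    | zero => intro _; rw [h0]
    | succ k ih => exact fun hk => (hstep k hk).2.trans (ih (Nat.le_of_succ_le hk))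
  rw [← hK]
  exact this K le_rfl

lemma IsTypical.norm_sub_le_of_ladObjective_le (H : IsTypical x ξ B η) (hB : 1 ≤ B)
    (hη : η ≤ 1 / 2) (hn : 0 < n) (hy : ∀ i, y i = inner ℝ (x i) βs + ξ i)
    {b0 bL : EuclideanSpace ℝ (Fin p)} (hlad : ladObjective x y bL ≤ ladObjective x y b0) :
    ‖bL - βs‖ ≤ 8 * B * (2 * B + B * ‖b0 - βs‖) := by
  have hn' : (0 : ℝ) < n := by exact_mod_cast hn
  have h1 := H.le_sum_abs_inner hB hη (bL - βs)
  have hξ := H.sum_le fun i => abs_le_envelope (x i) (ξ i)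
  have hx := H.sum_le fun i => norm_le_envelope (x i) (ξ i)
  have h2 : ∑ i, |(inner ℝ (x i) (bL - βs) : ℝ)| ≤ ladObjective x y bL + ∑ i, |ξ i| := by
    rw [ladObjective, ← Finset.sum_add_distrib]
    refine Finset.sum_le_sum fun i _ => ?_
    rw [residual_eq hy, add_comm]
    have := abs_sub (ξ i) (ξ i - inner ℝ (x i) (bL - βs))
    rwa [sub_sub_cancel] at this
  have h3 : ladObjective x y b0 ≤ ∑ i, |ξ i| + (∑ i, ‖x i‖) * ‖b0 - βs‖ := by
    rw [ladObjective, Finset.sum_mul, ← Finset.sum_add_distrib]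
    refine Finset.sum_le_sum fun i _ => ?_
    rw [residual_eq hy]
    exact (abs_sub _ _).trans (add_le_add le_rfl (abs_real_inner_le_norm _ _))
  have h4 := mul_le_mul_of_nonneg_right hx (norm_nonneg (b0 - βs))
  have h5 : (n : ℝ) * (‖bL - βs‖ / (8 * B)) ≤ n * (2 * B + B * ‖b0 - βs‖) := by linarith
  have h6 := le_of_mul_le_mul_left h5 hn'
  rwa [div_le_iff₀ (by positivity), mul_comm] at h6

/-- Since 1 - exp(-v) ≤ v, the Welsch loss is at most half the squared residual, whatever τ is. -/
lemma IsTypical.welschObjective_le (H : IsTypical x ξ B η) (hn : 0 < n) (hτ : 0 < τ)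
    (hy : ∀ i, y i = inner ℝ (x i) βs + ξ i) {M : ℝ} {b : EuclideanSpace ℝ (Fin p)}
    (hb : ‖b - βs‖ ≤ M) : welschObjective x y τ b ≤ B * (1 + M ^ 2) := by
  have hn' : (0 : ℝ) < n := by exact_mod_cast hn
  have hM : 0 ≤ M := (norm_nonneg _).trans hb
  have hpt : ∀ i, (1 / τ) * (1 - Real.exp (-(τ * residual x y b i ^ 2) / 2))
      ≤ envelope (x i) (ξ i) * (1 + M ^ 2) := by
    intro i
    have h1 := Real.add_one_le_exp (-(τ * residual x y b i ^ 2) / 2)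
    have h2 : (1 / τ) * (1 - Real.exp (-(τ * residual x y b i ^ 2) / 2))
        ≤ (1 / τ) * (τ * residual x y b i ^ 2 / 2) := by gcongr; linarith
    have h3 : (1 / τ) * (τ * residual x y b i ^ 2 / 2) = residual x y b i ^ 2 / 2 := by
      field_simp
    have h4 : |(inner ℝ (x i) (b - βs) : ℝ)| ≤ ‖x i‖ * M :=
      (abs_real_inner_le_norm _ _).trans (by gcongr)
    have h5 := pow_le_pow_left₀ (abs_nonneg _) h4 2
    rw [sq_abs] at h5
    have h6 := sq_le_envelope (x i) (ξ i)
    have h7 := mul_le_mul_of_nonneg_right (norm_sq_le_envelope (x i) (ξ i)) (sq_nonneg M)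
    rw [h3, residual_eq hy] at h2
    rw [residual_eq hy]
    nlinarith [sq_nonneg (ξ i + inner ℝ (x i) (b - βs))]
  have hs := Finset.sum_le_sum fun i (_ : i ∈ Finset.univ) => hpt i
  rw [← Finset.sum_mul] at hs
  have h8 := mul_le_mul_of_nonneg_right H.envelope_le (by positivity : 0 ≤ 1 + M ^ 2)
  rw [welschObjective, one_div, inv_mul_le_iff₀ hn']
  linarith

/-- If τr²/2 ≤ 1, the loss is at least r²/4 and controls |r|. Otherwise the loss is at least 1/(2τ),
and |a| ≤ z t is split by Young's inequality z ≤ δz² + 1/(4δ), whose constant term is paid by the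
loss. -/
lemma abs_le_add_welsch (hτ : 0 < τ) {t δ r s a z : ℝ} (ht : 0 ≤ t) (hδ : 0 < δ)
    (ha : |a| ≤ |s| + |r|) (ha' : |a| ≤ z * t) :
    |a| ≤ |s| + 1 + t * δ * z ^ 2
      + (1 + t * τ / (2 * δ)) * ((1 / τ) * (1 - Real.exp (-(τ * r ^ 2) / 2))) := by
  have hexp : Real.exp (-(τ * r ^ 2) / 2) ≤ 1 :=
    Real.exp_le_one_iff.mpr (by nlinarith [mul_nonneg hτ.le (sq_nonneg r)])
  set w := (1 / τ) * (1 - Real.exp (-(τ * r ^ 2) / 2)) with hw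
  have hw0 : 0 ≤ w := mul_nonneg (by positivity) (by linarith)
  have hrest : 0 ≤ t * τ / (2 * δ) * w := by positivity
  have hrest' : 0 ≤ t * δ * z ^ 2 := by positivity
  have hinv : ∀ u : ℝ, 0 ≤ u → Real.exp (-u) ≤ 1 / (1 + u) := by
    intro u hu
    rw [Real.exp_neg, ← one_div]
    exact one_div_le_one_div_of_le (by linarith) (by linarith [Real.add_one_le_exp u])
  have hX : 0 ≤ τ * r ^ 2 / 2 := by positivity
  have he := hinv _ hX
  rw [show -(τ * r ^ 2 / 2) = -(τ * r ^ 2) / 2 by ring] at he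
  by_cases hc : τ * r ^ 2 / 2 ≤ 1
  · have h1 : τ * r ^ 2 / 2 / 2 ≤ 1 - Real.exp (-(τ * r ^ 2) / 2) := by
      have : 1 / (1 + τ * r ^ 2 / 2) ≤ 1 - τ * r ^ 2 / 2 / 2 := by
        rw [div_le_iff₀ (by linarith)]
        nlinarith
      linarith
    have h2 : r ^ 2 / 4 ≤ w := by
      have := mul_le_mul_of_nonneg_left h1 (by positivity : 0 ≤ 1 / τ)
      rwa [show 1 / τ * (τ * r ^ 2 / 2 / 2) = r ^ 2 / 4 by field_simp; ring] at this
    have h3 : |r| ≤ 1 + r ^ 2 / 4 := by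
      rw [← sq_abs]
      nlinarith [sq_nonneg (|r| - 2)]
    linarith
  · push Not at hc
    have h1 : 1 / 2 ≤ 1 - Real.exp (-(τ * r ^ 2) / 2) := by
      have : 1 / (1 + τ * r ^ 2 / 2) ≤ 1 / 2 := one_div_le_one_div_of_le (by norm_num) (by linarith)
      linarith
    have h2 : 1 / 2 ≤ τ * w := by
      rw [hw, ← mul_assoc, mul_one_div_cancel hτ.ne', one_mul]
      exact h1
    have h3 : t * (1 / (4 * δ)) ≤ t * τ / (2 * δ) * w := by
      have := mul_le_mul_of_nonneg_left h2 (by positivity : 0 ≤ t / (2 * δ))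
      calc t * (1 / (4 * δ)) = t / (2 * δ) * (1 / 2) := by field_simp; ring
        _ ≤ t / (2 * δ) * (τ * w) := this
        _ = _ := by ring
    have h4 : z ≤ δ * z ^ 2 + 1 / (4 * δ) := by
      have : δ * z ^ 2 + 1 / (4 * δ) - z = (2 * δ * z - 1) ^ 2 / (4 * δ) := by field_simp; ring
      have h5 : 0 ≤ (2 * δ * z - 1) ^ 2 / (4 * δ) := by positivity
      linarith
    have h5 := mul_le_mul_of_nonneg_right h4 ht
    nlinarith [abs_nonneg s]

lemma IsTypical.norm_sub_le_of_welschObjective_le (H : IsTypical x ξ B η) (hB : 1 ≤ B)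
    (hη : η ≤ 1 / 2) (hn : 0 < n) (hτ : 0 < τ) (hy : ∀ i, y i = inner ℝ (x i) βs + ξ i)
    {C : ℝ} (hτC : 512 * B ^ 3 * C * τ ≤ 1)
    {b : EuclideanSpace ℝ (Fin p)} (hb : welschObjective x y τ b ≤ C) :
    ‖b - βs‖ ≤ 16 * B * (B + 1 + C) := by
  have hn' : (0 : ℝ) < n := by exact_mod_cast hn
  set t := ‖b - βs‖ with ht
  have ht0 : 0 ≤ t := norm_nonneg _
  -- This δ makes the Young term t/(32B) on average; the smallness of τ does the same for the
  -- saturated residuals. Both are absorbed by the lower bound t/(8B), leaving t/(16B).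
  have hδ : 0 < 1 / (32 * B ^ 2) := by positivity
  have h1 := H.le_sum_abs_inner hB hη (b - βs)
  have hξ := H.sum_le fun i => abs_le_envelope (x i) (ξ i)
  have hx := H.sum_le fun i => norm_sq_le_envelope (x i) (ξ i)
  have hpt := fun i => abs_le_add_welsch hτ ht0 hδ (s := ξ i) (r := residual x y b i)
    (a := inner ℝ (x i) (b - βs)) (z := ‖x i‖)
    (by
      rw [residual_eq hy]
      have := abs_sub (ξ i) (ξ i - inner ℝ (x i) (b - βs))
      rwa [sub_sub_cancel] at this)
    (abs_real_inner_le_norm _ _)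
  have hs := Finset.sum_le_sum fun i (_ : i ∈ Finset.univ) => hpt i
  rw [Finset.sum_add_distrib, Finset.sum_add_distrib, Finset.sum_add_distrib, ← Finset.mul_sum,
    ← Finset.mul_sum] at hs
  simp only [Finset.sum_const, Finset.card_univ, Fintype.card_fin, nsmul_eq_mul, mul_one] at hs
  rw [welschObjective, one_div, inv_mul_le_iff₀ hn'] at hb
  have hx' := mul_le_mul_of_nonneg_left hx (by positivity : 0 ≤ t * (1 / (32 * B ^ 2)))
  have hb' := mul_le_mul_of_nonneg_left hb
    (by positivity : 0 ≤ 1 + t * τ / (2 * (1 / (32 * B ^ 2))))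
  have e1 : t * (1 / (32 * B ^ 2)) * (n * B) = n * (t / (32 * B)) := by field_simp
  have e2 : (1 + t * τ / (2 * (1 / (32 * B ^ 2)))) * (n * C) = n * (C + 16 * B ^ 2 * C * τ * t) := by
    field_simp; ring
  have e3 : 16 * B ^ 2 * C * τ * t ≤ t / (32 * B) := by
    rw [le_div_iff₀ (by positivity)]
    calc 16 * B ^ 2 * C * τ * t * (32 * B) = 512 * B ^ 3 * C * τ * t := by ring
      _ ≤ 1 * t := by gcongr
      _ = t := one_mul t
  have e3' := mul_le_mul_of_nonneg_left e3 hn'.le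
  rw [e1] at hx'
  rw [e2] at hb'
  have h5 : (n : ℝ) * (t / (8 * B)) ≤ n * (B + 1 + C + t / (32 * B) + t / (32 * B)) := by
    linarith
  have h6 := le_of_mul_le_mul_left h5 hn'
  have h7 : t / (8 * B) - t / (32 * B) - t / (32 * B) = t / (16 * B) := by field_simp; ring
  have h8 : t / (16 * B) ≤ B + 1 + C := by linarith
  rwa [div_le_iff₀ (by positivity), mul_comm] at h8

/-! ### The score equation and its linearization -/

lemma hasDerivAt_score (τ s : ℝ) :
    HasDerivAt (score τ) ((1 - τ * s ^ 2) * Real.exp (-(τ * s ^ 2) / 2)) s := by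
  have h1 : HasDerivAt (fun s : ℝ => -(τ * s ^ 2) / 2) (-(τ * s)) s := by
    have := (((hasDerivAt_id s).pow 2).const_mul τ).neg.div_const 2
    refine this.congr_deriv ?_
    simp
    ring
  have h2 := (hasDerivAt_id s).mul h1.exp
  refine h2.congr_deriv ?_
  simp
  ring

/-- Mean value inequality for r ↦ ψ_τ(r) - r, whose derivative is at most (3/2)τr² in absolute
value, with r² ≤ 2s² + 2a² on the segment. -/
lemma abs_score_sub_add_le (hτ : 0 ≤ τ) (s a : ℝ) :
    |score τ (s - a) - score τ s + a| ≤ 3 * τ * (s ^ 2 + a ^ 2) * |a| := by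
  have hd : ∀ r ∈ Set.uIcc s (s - a), HasDerivWithinAt (fun r => score τ r - r)
      ((1 - τ * r ^ 2) * Real.exp (-(τ * r ^ 2) / 2) - 1) (Set.uIcc s (s - a)) r :=
    fun r _ => ((hasDerivAt_score τ r).sub (hasDerivAt_id r)).hasDerivWithinAt
  have hb : ∀ r ∈ Set.uIcc s (s - a),
      ‖(1 - τ * r ^ 2) * Real.exp (-(τ * r ^ 2) / 2) - 1‖ ≤ 3 * τ * (s ^ 2 + a ^ 2) := by
    intro r hr
    have hrs : r ^ 2 ≤ 2 * s ^ 2 + 2 * a ^ 2 := by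
      have h1 : |r - s| ≤ |s - a - s| := Set.abs_sub_left_of_mem_uIcc hr
      have h2 := pow_le_pow_left₀ (abs_nonneg _) h1 2
      rw [sq_abs, sq_abs] at h2
      nlinarith [sq_nonneg (r - 2 * s)]
    have hX : 0 ≤ τ * r ^ 2 := by positivity
    have he1 : Real.exp (-(τ * r ^ 2) / 2) ≤ 1 := Real.exp_le_one_iff.mpr (by linarith)
    have he2 := Real.add_one_le_exp (-(τ * r ^ 2) / 2)
    have he0 := Real.exp_pos (-(τ * r ^ 2) / 2)
    have hXle : τ * r ^ 2 ≤ τ * (2 * s ^ 2 + 2 * a ^ 2) := by gcongr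
    set X := τ * r ^ 2
    set e := Real.exp (-X / 2)
    rw [Real.norm_eq_abs, abs_le]
    constructor <;> nlinarith [mul_nonneg hX he0.le]
  have := (convex_uIcc s (s - a)).norm_image_sub_le_of_norm_hasDerivWithin_le hd hb
    Set.left_mem_uIcc Set.right_mem_uIcc
  simp only [Real.norm_eq_abs] at this
  rw [show s - a - s = -a by ring, abs_neg] at this
  rwa [show score τ (s - a) - score τ s + a = score τ (s - a) - (s - a) - (score τ s - s) by ring]

/-- The derivative of the objective in the direction of the score sum v itself is -‖v‖²/n, so no
formula for the full gradient is needed. -/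
lemma sum_score_smul_eq_zero (hn : 0 < n) (hτ : τ ≠ 0) {b : EuclideanSpace ℝ (Fin p)}
    (hb : fderiv ℝ (welschObjective x y τ) b = 0) :
    ∑ i, score τ (residual x y b i) • x i = 0 := by
  have hn' : (n : ℝ) ≠ 0 := by exact_mod_cast hn.ne'
  set v := ∑ i, score τ (residual x y b i) • x i with hv
  have hdiff : DifferentiableAt ℝ (welschObjective x y τ) b := by
    unfold welschObjective residual
    simp only [← innerSL_apply_apply ℝ]
    fun_prop
  have hline : HasDerivAt (fun s : ℝ => b + s • v) v 0 := by
    simpa using ((hasDerivAt_id (0 : ℝ)).smul_const v).const_add b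
  have hb0 : HasFDerivAt (welschObjective x y τ) (0 : EuclideanSpace ℝ (Fin p) →L[ℝ] ℝ)
      (b + (0 : ℝ) • v) := by
    rw [zero_smul, add_zero, ← hb]
    exact hdiff.hasFDerivAt
  have h1 : HasDerivAt (fun s : ℝ => welschObjective x y τ (b + s • v)) 0 0 := by
    simpa using! hb0.comp_hasDerivAt 0 hline
  have hres : ∀ i, HasDerivAt (fun s : ℝ => residual x y (b + s • v) i)
      (-(inner ℝ (x i) v : ℝ)) 0 := by
    intro i
    have : (fun s : ℝ => residual x y (b + s • v) i)
        = fun s => residual x y b i - s * inner ℝ (x i) v := by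
      ext s
      simp only [residual, inner_add_right, real_inner_smul_right]
      ring
    rw [this]
    simpa using ((hasDerivAt_id (0 : ℝ)).mul_const (inner ℝ (x i) v : ℝ)).const_sub
      (residual x y b i)
  have hterm : ∀ i, HasDerivAt (fun s : ℝ => (1 / τ) *
      (1 - Real.exp (-(τ * residual x y (b + s • v) i ^ 2) / 2)))
      (-(score τ (residual x y b i) * inner ℝ (x i) v)) 0 := by
    intro i
    have := (((((hres i).pow 2).const_mul τ).neg.div_const 2).exp.const_sub 1).const_mul (1 / τ)
    refine this.congr_deriv ?_
    simp [score]
    field_simp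
  have h2 := (HasDerivAt.fun_sum (u := Finset.univ) fun i _ => hterm i).const_mul (1 / (n : ℝ))
  have h3 := h1.unique h2
  have h4 : ∑ i, score τ (residual x y b i) * (inner ℝ (x i) v : ℝ) = inner ℝ v v := by
    conv_rhs => rw [hv, sum_inner]
    simp only [real_inner_smul_left, hv]
  rw [Finset.sum_neg_distrib, h4] at h3
  have h5 : (inner ℝ v v : ℝ) = 0 := by
    have h6 := h3.symm
    rw [mul_neg, neg_eq_zero] at h6
    exact (mul_eq_zero.mp h6).resolve_left (one_div_ne_zero hn')
  exact inner_self_eq_zero.mp h5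

/-- One factor ‖h‖ of the cubic remainder is kept and the other two are bounded by M, which makes
the error relative. -/
lemma IsTypical.norm_linearization_le (H : IsTypical x ξ B η) (hn : 0 < n) (hτ : 0 < τ)
    (hy : ∀ i, y i = inner ℝ (x i) βs + ξ i) {M : ℝ} {b : EuclideanSpace ℝ (Fin p)}
    (hb : fderiv ℝ (welschObjective x y τ) b = 0) (hM : ‖b - βs‖ ≤ M) :
    ‖(n : ℝ) • (b - βs) - ∑ i, score τ (ξ i) • x i‖
      ≤ n * (η + 3 * τ * B * (1 + M ^ 2)) * ‖b - βs‖ := by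
  have h0 := sum_score_smul_eq_zero hn hτ.ne' hb
  simp only [residual_eq hy] at h0
  set h := b - βs
  have hsplit : (n : ℝ) • h - ∑ i, score τ (ξ i) • x i
      = -(∑ i, (inner ℝ (x i) h : ℝ) • x i - (n : ℝ) • h)
        + ∑ i, (score τ (ξ i - inner ℝ (x i) h) - score τ (ξ i) + inner ℝ (x i) h) • x i := by
    simp only [add_smul, sub_smul, Finset.sum_add_distrib, Finset.sum_sub_distrib, h0]
    abel
  have hrem : ‖∑ i, (score τ (ξ i - inner ℝ (x i) h) - score τ (ξ i) + inner ℝ (x i) h) • x i‖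
      ≤ 3 * τ * (1 + M ^ 2) * ‖h‖ * ∑ i, envelope (x i) (ξ i) := by
    rw [Finset.mul_sum]
    refine norm_sum_le_of_le _ fun i _ => ?_
    rw [norm_smul, Real.norm_eq_abs]
    have h1 := abs_score_sub_add_le hτ.le (ξ i) (inner ℝ (x i) h)
    have hcs : |(inner ℝ (x i) h : ℝ)| ≤ ‖x i‖ * ‖h‖ := abs_real_inner_le_norm _ _
    have hsq : (inner ℝ (x i) h : ℝ) ^ 2 ≤ ‖x i‖ ^ 2 * M ^ 2 := by
      rw [← sq_abs, ← mul_pow]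
      gcongr
      exact hcs.trans (by gcongr)
    calc _ ≤ (3 * τ * (ξ i ^ 2 + (inner ℝ (x i) h : ℝ) ^ 2) * |(inner ℝ (x i) h : ℝ)|) * ‖x i‖ := by
          gcongr
      _ ≤ (3 * τ * (ξ i ^ 2 + ‖x i‖ ^ 2 * M ^ 2) * (‖x i‖ * ‖h‖)) * ‖x i‖ := by gcongr
      _ = 3 * τ * ‖h‖ * (‖x i‖ ^ 2 * ξ i ^ 2 + ‖x i‖ ^ 4 * M ^ 2) := by ring
      _ ≤ 3 * τ * ‖h‖ * (envelope (x i) (ξ i) + envelope (x i) (ξ i) * M ^ 2) := by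
          gcongr
          · exact norm_sq_mul_sq_le_envelope _ _
          · exact norm_pow_four_le_envelope _ _
      _ = _ := by ring
  have henv := mul_le_mul_of_nonneg_left H.envelope_le
    (by positivity : 0 ≤ 3 * τ * (1 + M ^ 2) * ‖h‖)
  rw [hsplit]
  refine (norm_add_le _ _).trans ?_
  rw [norm_neg]
  calc _ ≤ n * η * ‖h‖ + 3 * τ * (1 + M ^ 2) * ‖h‖ * (n * B) :=
        add_le_add (H.covariance_le h) (hrem.trans henv)
    _ = _ := by ring

end Deterministic

/-- Every output of the algorithm on typical data is, up to a small relative error, equal to the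
average of the scores of the noise. -/
theorem exists_forall_isAlgorithmOutput_norm_le {p : ℕ} {B ε : ℝ} (hB : 1 ≤ B) (hε : 0 < ε)
    (hε' : ε ≤ 1) (βs b0 : EuclideanSpace ℝ (Fin p)) :
    ∃ τ₀ > 0, ∀ (n : ℕ) (x : Fin n → EuclideanSpace ℝ (Fin p)) (ξ y : Fin n → ℝ) (τ c : ℝ)
      (b : EuclideanSpace ℝ (Fin p)), 0 < n → 0 < τ → τ ≤ τ₀ →
      (∀ i, y i = inner ℝ (x i) βs + ξ i) → IsTypical x ξ B (ε / 2) →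
      IsAlgorithmOutput x y τ c b0 b →
      ‖(n : ℝ) • (b - βs) - ∑ i, score τ (ξ i) • x i‖ ≤ n * ε * ‖b - βs‖ := by
  -- L bounds the distance to β* after the first stage, C the Welsch value there, M the distance of
  -- the final output. The two terms of the minimum serve the bound by M and the linearization
  -- error.
  set L := 8 * B * (2 * B + B * ‖b0 - βs‖)
  set C := B * (1 + L ^ 2)
  set M := 16 * B * (B + 1 + C)
  have hC : 0 < C := by positivity
  refine ⟨min (1 / (512 * B ^ 3 * C)) (ε / (6 * B * (1 + M ^ 2))), by positivity, ?_⟩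
  intro n x ξ y τ c b hn hτ hτ₀ hy H hout
  obtain ⟨bL, h1, hgrad, hle⟩ := hout
  have hη : ε / 2 ≤ 1 / 2 := by linarith
  have hL := H.norm_sub_le_of_ladObjective_le hB hη hn hy h1.ladObjective_le
  have hfC := hle.trans (H.welschObjective_le hn hτ hy hL)
  have hτ1 : 512 * B ^ 3 * C * τ ≤ 1 := by
    have := hτ₀.trans (min_le_left _ _)
    rw [le_div_iff₀ (by positivity)] at this
    linarith
  have hτ2 : 3 * τ * B * (1 + M ^ 2) ≤ ε / 2 := by
    have := hτ₀.trans (min_le_right _ _)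
    rw [le_div_iff₀ (by positivity)] at this
    linarith
  have hM := H.norm_sub_le_of_welschObjective_le hB hη hn hτ hy hτ1 hfC
  refine (H.norm_linearization_le hn hτ hy hgrad hM).trans ?_
  gcongr
  linarith

end WelschRegression
end

noncomputable section

namespace WelschRegression

/-! ### Central limit theorem for isotropic vectors -/

section CentralLimitTheorem

variable {Ω E : Type*} [MeasurableSpace Ω] {μ : Measure Ω}
  [NormedAddCommGroup E] [InnerProductSpace ℝ E] [FiniteDimensional ℝ E] [MeasurableSpace E]
  [BorelSpace E] {Z : ℕ → Ω → E}

lemma charFun_map_smul_eq_charFun_map_inner {W : Ω → E} (hW : AEMeasurable W μ) (e : E) (s : ℝ) :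
    charFun (μ.map W) (s • e) = charFun (μ.map fun ω => (inner ℝ (W ω) e : ℝ)) s := by
  rw [charFun_apply, charFun_apply_real, integral_map hW (by fun_prop),
    integral_map (by fun_prop) (by fun_prop)]
  simp only [real_inner_smul_right, Complex.ofReal_mul]

/-- The **central limit theorem** in a finite-dimensional inner product space, for centered
isotropic random vectors. -/
theorem tendstoInDistribution_inv_sqrt_smul_sum [IsProbabilityMeasure μ] (hindep : iIndepFun Z μ)
    (hident : ∀ i, IdentDistrib (Z i) (Z 0) μ μ)
    (h0 : ∀ t : E, ∫ ω, (inner ℝ (Z 0 ω) t : ℝ) ∂μ = 0)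
    (h1 : ∀ t : E, ∫ ω, (inner ℝ (Z 0 ω) t : ℝ) ^ 2 ∂μ = ‖t‖ ^ 2) :
    TendstoInDistribution (fun (n : ℕ) ω => (√(n : ℝ))⁻¹ • ∑ k ∈ Finset.range n, Z k ω) atTop
      (fun z => z) (fun _ => μ) (stdGaussian E) where
  forall_aemeasurable n :=
    (Finset.aemeasurable_fun_sum _ fun _ _ => (hident _).aemeasurable_fst).const_smul _
  tendsto := by
    have hm i := (hident i).aemeasurable_fst
    refine ProbabilityMeasure.tendsto_iff_tendsto_charFun.2 fun t => ?_
    have hchar : ∀ n : ℕ, charFun (μ.map fun ω => (√(n : ℝ))⁻¹ • ∑ k ∈ Finset.range n, Z k ω) t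
        = (charFun (μ.map (Z 0)) ((√(n : ℝ))⁻¹ • t)) ^ n := by
      intro n
      rw [charFun_map_smul_comp (Finset.aemeasurable_fun_sum _ fun _ _ => hm _),
        (hindep.restrict _).charFun_map_fun_finsetSum_eq_prod fun _ _ => hm _]
      simp [fun i => (hident i).map_eq]
    have hlim : charFun ((stdGaussian E).map fun z => z) t = Complex.exp (-(‖t‖ : ℂ) ^ 2 / 2) := by
      rw [Measure.map_id', charFun_stdGaussian]
    simp only [ProbabilityMeasure.coe_mk, hchar, hlim]
    rcases eq_or_ne t 0 with rfl | ht
    · have := Measure.isProbabilityMeasure_map (μ := μ) (hm 0)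
      simp
    have ht' : ‖t‖ ≠ 0 := norm_ne_zero_iff.mpr ht
    -- Cramér–Wold reduction: the real central limit theorem for the unit-variance projection on e,
    -- at frequency ‖t‖.
    set e := ‖t‖⁻¹ • t with he
    have hte : t = ‖t‖ • e := by rw [he, smul_inv_smul₀ ht']
    have he1 : ‖e‖ = 1 := by rw [he, norm_smul, norm_inv, norm_norm, inv_mul_cancel₀ ht']
    have key := tendsto_charFun_inv_sqrt_mul_pow (P := μ) (X := fun ω => (inner ℝ (Z 0 ω) e : ℝ))
      (by have := hm 0; fun_prop) (h0 e) (by simpa [he1] using h1 e) ‖t‖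
    refine key.congr fun n => ?_
    conv_rhs => rw [hte, smul_smul]
    rw [charFun_map_smul_eq_charFun_map_inner (hm 0)]

end CentralLimitTheorem

/-! ### Second moments of sums of independent vectors -/

variable {Ω : Type*} [MeasurableSpace Ω] {μ : Measure Ω} {p : ℕ}

lemma norm_sq_eq_sum_coord_mul_coord (v : EuclideanSpace ℝ (Fin p)) :
    ‖v‖ ^ 2 = ∑ j, v j * v j := by
  simp only [EuclideanSpace.real_norm_sq_eq, ← sq]

lemma integrable_norm_sq_sum {Z : ℕ → Ω → EuclideanSpace ℝ (Fin p)} (hZ : ∀ i, MemLp (Z i) 2 μ)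
    (n : ℕ) : Integrable (fun ω => ‖∑ k ∈ Finset.range n, Z k ω‖ ^ 2) μ :=
  (memLp_finsetSum _ fun k _ => hZ k).integrable_norm_pow (by norm_num)

lemma integral_norm_sq_sum [IsProbabilityMeasure μ]
    {Z : ℕ → Ω → EuclideanSpace ℝ (Fin p)} (hindep : iIndepFun Z μ)
    (hident : ∀ i, IdentDistrib (Z i) (Z 0) μ μ) (hZ : MemLp (Z 0) 2 μ)
    (h0 : ∀ j, ∫ ω, Z 0 ω j ∂μ = 0) (n : ℕ) :
    ∫ ω, ‖∑ k ∈ Finset.range n, Z k ω‖ ^ 2 ∂μ = n * ∫ ω, ‖Z 0 ω‖ ^ 2 ∂μ := by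
  have hZi : ∀ i, MemLp (Z i) 2 μ := fun i => (hident i).memLp_iff.2 hZ
  have hmeas : ∀ j, Measurable fun v : EuclideanSpace ℝ (Fin p) => v j := fun j => by fun_prop
  have hcoord : ∀ i j, MemLp (fun ω => Z i ω j) 2 μ := fun i j =>
    (EuclideanSpace.proj (𝕜 := ℝ) j).comp_memLp' (hZi i)
  have hsum : ∀ j, MemLp (fun ω => ∑ k ∈ Finset.range n, Z k ω j) 2 μ := fun j =>
    memLp_finsetSum _ fun k _ => hcoord k j
  have hidj : ∀ i j, IdentDistrib (fun ω => Z i ω j) (fun ω => Z 0 ω j) μ μ := fun i j =>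
    (hident i).comp (hmeas j)
  have hvar : ∀ j, ∫ ω, (∑ k ∈ Finset.range n, Z k ω j) ^ 2 ∂μ = n * ∫ ω, Z 0 ω j ^ 2 ∂μ := by
    intro j
    have hm : ∫ ω, ∑ k ∈ Finset.range n, Z k ω j ∂μ = 0 := by
      rw [integral_finsetSum _ fun k _ => (hcoord k j).integrable (by norm_num)]
      exact Finset.sum_eq_zero fun k _ => (hidj k j).integral_eq.trans (h0 j)
    rw [← variance_of_integral_eq_zero (hsum j).aemeasurable hm,
      ← variance_of_integral_eq_zero (hcoord 0 j).aemeasurable (h0 j)]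
    have := IndepFun.variance_sum (X := fun k ω => Z k ω j) (s := Finset.range n) (μ := μ)
      (fun i _ => hcoord i j)
      (fun a _ b _ hab => (hindep.indepFun hab).comp (hmeas j) (hmeas j))
    rw [show (fun ω => ∑ k ∈ Finset.range n, Z k ω j) = ∑ k ∈ Finset.range n, fun ω => Z k ω j by
      ext ω; simp, this, Finset.sum_congr rfl fun k _ => (hidj k j).variance_eq]
    simp
  simp only [EuclideanSpace.real_norm_sq_eq, WithLp.ofLp_sum, Finset.sum_apply]
  rw [integral_finsetSum _ fun j _ => (hsum j).integrable_sq,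
    integral_finsetSum _ fun j _ => (hcoord 0 j).integrable_sq, Finset.mul_sum]
  exact Finset.sum_congr rfl fun j _ => hvar j

/-- The covariates and the noise of a linear model with random design: the pairs `(X_i, ξ_i)` are
i.i.d., the noise is independent of the covariate and has unit second moment, and the covariates
are centered, isotropic and sub-Gaussian. -/
structure IsRandomDesign (μ : Measure Ω) (X : ℕ → Ω → EuclideanSpace ℝ (Fin p))
    (ξ : ℕ → Ω → ℝ) : Prop where
  measurable_covariate : ∀ i, Measurable (X i)
  measurable_noise : ∀ i, Measurable (ξ i)
  iIndepFun : iIndepFun (fun i ω => (X i ω, ξ i ω)) μ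
  identDistrib : ∀ i, IdentDistrib (fun ω => (X i ω, ξ i ω)) (fun ω => (X 0 ω, ξ 0 ω)) μ μ
  indepFun : IndepFun (X 0) (ξ 0) μ
  integral_covariate : ∫ ω, X 0 ω ∂μ = 0
  isIsotropic : IsIsotropic μ (X 0)
  isOneSubGaussian : IsOneSubGaussian μ (X 0)
  memLp_noise : MemLp (ξ 0) 2 μ
  integral_noise_sq : ∫ ω, ξ 0 ω ^ 2 ∂μ = 1

/-! ### Moments and normalized sums of the random design -/

namespace IsRandomDesign

variable {X : ℕ → Ω → EuclideanSpace ℝ (Fin p)} {ξ : ℕ → Ω → ℝ} {φ : ℝ → ℝ}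

lemma integral_norm_sq (D : IsRandomDesign μ X ξ) : ∫ ω, ‖X 0 ω‖ ^ 2 ∂μ = p := by
  simp only [norm_sq_eq_sum_coord_mul_coord]
  rw [integral_finsetSum _ fun j _ => (D.isIsotropic j j).1]
  simp [(D.isIsotropic _ _).2]

lemma integrable_norm_sq (D : IsRandomDesign μ X ξ) : Integrable (fun ω => ‖X 0 ω‖ ^ 2) μ := by
  simp only [norm_sq_eq_sum_coord_mul_coord]
  exact integrable_finsetSum _ fun j _ => (D.isIsotropic j j).1

lemma memLp_covariate (D : IsRandomDesign μ X ξ) : MemLp (X 0) 2 μ :=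
  (memLp_two_iff_integrable_sq_norm (D.measurable_covariate 0).aestronglyMeasurable).2
    D.integrable_norm_sq

lemma integral_coord [IsProbabilityMeasure μ] (D : IsRandomDesign μ X ξ) (j : Fin p) : ∫ ω, X 0 ω j ∂μ = 0 := by
  have := (EuclideanSpace.proj (𝕜 := ℝ) j).integral_comp_comm
    (D.memLp_covariate.integrable (by norm_num))
  rw [D.integral_covariate, map_zero] at this
  exact this

lemma integrable_norm_pow_four (D : IsRandomDesign μ X ξ) :
    Integrable (fun ω => ‖X 0 ω‖ ^ 4) μ := by
  have hcoord : ∀ j, Integrable (fun ω => X 0 ω j ^ 4) μ := by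
    intro j
    -- Exponential moments at ±1 along a coordinate axis give all polynomial moments of that
    -- coordinate.
    refine integrable_pow_of_integrable_exp_mul (t := 1) one_ne_zero ?_ ?_ 4
    · simpa [EuclideanSpace.inner_single_left] using
        (D.isOneSubGaussian (EuclideanSpace.single j 1)).1
    · simpa [EuclideanSpace.inner_single_left] using
        (D.isOneSubGaussian (EuclideanSpace.single j (-1))).1
  refine ((integrable_finsetSum Finset.univ fun j _ => hcoord j).const_mul (p : ℝ)).mono'
    ((D.measurable_covariate 0).norm.pow_const 4).aestronglyMeasurable (ae_of_all _ fun ω => ?_)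
  rw [Real.norm_of_nonneg (by positivity), show ‖X 0 ω‖ ^ 4 = (‖X 0 ω‖ ^ 2) ^ 2 by ring,
    EuclideanSpace.real_norm_sq_eq]
  have := sq_sum_le_card_mul_sum_sq (s := Finset.univ) (f := fun j => X 0 ω j ^ 2)
  simpa [← pow_mul] using this

/-- The envelope is a product of a function of X and a function of ξ, so by independence two moments
of the noise suffice. -/
lemma integrable_envelope [IsProbabilityMeasure μ] (D : IsRandomDesign μ X ξ) :
    Integrable (fun ω => envelope (X 0 ω) (ξ 0 ω)) μ := by
  have hind : IndepFun (fun ω => 1 + ‖X 0 ω‖ ^ 4) (fun ω => 1 + ξ 0 ω ^ 2) μ :=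
    D.indepFun.comp (φ := fun v => 1 + ‖v‖ ^ 4) (ψ := fun s => 1 + s ^ 2)
      (by fun_prop) (by fun_prop)
  exact hind.integrable_mul ((integrable_const 1).add D.integrable_norm_pow_four)
    ((integrable_const 1).add D.memLp_noise.integrable_sq)

lemma memLp_comp_noise (D : IsRandomDesign μ X ξ) (hφ : Measurable φ) (hle : ∀ s, |φ s| ≤ |s|) :
    MemLp (fun ω => φ (ξ 0 ω)) 2 μ :=
  D.memLp_noise.mono (hφ.comp (D.measurable_noise 0)).aestronglyMeasurable
    (ae_of_all _ fun _ => hle _)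

lemma memLp_smul (D : IsRandomDesign μ X ξ) (hφ : Measurable φ) (hle : ∀ s, |φ s| ≤ |s|) :
    MemLp (fun ω => φ (ξ 0 ω) • X 0 ω) 2 μ := by
  have hm : Measurable fun ω => φ (ξ 0 ω) • X 0 ω :=
    (hφ.comp (D.measurable_noise 0)).smul (D.measurable_covariate 0)
  rw [memLp_two_iff_integrable_sq_norm hm.aestronglyMeasurable]
  simp only [norm_smul, mul_pow, Real.norm_eq_abs, sq_abs]
  exact (D.indepFun.symm.comp (φ := fun s => φ s ^ 2) (ψ := fun v => ‖v‖ ^ 2) (by fun_prop)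
    (by fun_prop)).integrable_mul (D.memLp_comp_noise hφ hle).integrable_sq D.integrable_norm_sq

lemma integral_norm_sq_smul (D : IsRandomDesign μ X ξ) (hφ : Measurable φ) :
    ∫ ω, ‖φ (ξ 0 ω) • X 0 ω‖ ^ 2 ∂μ = p * ∫ ω, φ (ξ 0 ω) ^ 2 ∂μ := by
  have hX := D.measurable_covariate 0
  have hξ := D.measurable_noise 0
  simp only [norm_smul, mul_pow, Real.norm_eq_abs, sq_abs]
  rw [← D.integral_norm_sq, mul_comm (∫ ω, ‖X 0 ω‖ ^ 2 ∂μ)]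
  exact (D.indepFun.symm.comp (φ := fun s => φ s ^ 2) (ψ := fun v => ‖v‖ ^ 2) (by fun_prop)
    (by fun_prop)).integral_fun_mul_eq_mul_integral
      ((hφ.comp hξ).pow_const 2).aestronglyMeasurable (hX.norm.pow_const 2).aestronglyMeasurable

/-- The mean factors, and the covariate factor vanishes. Hence φ(ξ) itself need not be centered: the
bias of the Welsch score on asymmetric noise disappears. -/
lemma integral_smul_coord [IsProbabilityMeasure μ] (D : IsRandomDesign μ X ξ) (hφ : Measurable φ) (j : Fin p) :
    ∫ ω, (φ (ξ 0 ω) • X 0 ω) j ∂μ = 0 := by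
  have hX := D.measurable_covariate 0
  have hξ := D.measurable_noise 0
  have := (D.indepFun.symm.comp (φ := φ) (ψ := fun v => v j) (by fun_prop)
    (by fun_prop)).integral_fun_mul_eq_mul_integral
      (hφ.comp hξ).aestronglyMeasurable
      (Measurable.aestronglyMeasurable (by simp only [Function.comp_def]; fun_prop))
  simp only [Function.comp_def, D.integral_coord, mul_zero] at this
  simpa using this

lemma iIndepFun_smul (D : IsRandomDesign μ X ξ) (hφ : Measurable φ) :
    ProbabilityTheory.iIndepFun (fun i ω => φ (ξ i ω) • X i ω) μ :=
  D.iIndepFun.comp (fun _ z => φ z.2 • z.1) fun _ => (hφ.comp measurable_snd).smul measurable_fst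

lemma identDistrib_smul (D : IsRandomDesign μ X ξ) (hφ : Measurable φ) (i : ℕ) :
    IdentDistrib (fun ω => φ (ξ i ω) • X i ω) (fun ω => φ (ξ 0 ω) • X 0 ω) μ μ :=
  (D.identDistrib i).comp (u := fun z : EuclideanSpace ℝ (Fin p) × ℝ => φ z.2 • z.1)
    ((hφ.comp measurable_snd).smul measurable_fst)

/-- The **Chebyshev inequality** for normalized sums. -/
lemma sq_mul_measureReal_le [IsProbabilityMeasure μ] (D : IsRandomDesign μ X ξ) (hφ : Measurable φ)
    (hle : ∀ s, |φ s| ≤ |s|) {δ : ℝ} (hδ : 0 ≤ δ) {n : ℕ} (hn : 0 < n) :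
    δ ^ 2 * μ.real {ω | δ ≤ ‖(√(n : ℝ))⁻¹ • ∑ k ∈ Finset.range n, φ (ξ k ω) • X k ω‖}
      ≤ p * ∫ ω, φ (ξ 0 ω) ^ 2 ∂μ := by
  have hn' : (0 : ℝ) < n := by exact_mod_cast hn
  have hLp : ∀ i, MemLp (fun ω => φ (ξ i ω) • X i ω) 2 μ := fun i =>
    (D.identDistrib_smul hφ i).memLp_iff.2 (D.memLp_smul hφ hle)
  have hsq : ∀ ω, ‖(√(n : ℝ))⁻¹ • ∑ k ∈ Finset.range n, φ (ξ k ω) • X k ω‖ ^ 2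
      = (n : ℝ)⁻¹ * ‖∑ k ∈ Finset.range n, φ (ξ k ω) • X k ω‖ ^ 2 := fun ω => by
    rw [norm_smul, mul_pow, norm_inv, Real.norm_of_nonneg (Real.sqrt_nonneg _), inv_pow,
      Real.sq_sqrt hn'.le]
  have hset : {ω | δ ≤ ‖(√(n : ℝ))⁻¹ • ∑ k ∈ Finset.range n, φ (ξ k ω) • X k ω‖}
      = {ω | δ ^ 2 ≤ (n : ℝ)⁻¹ * ‖∑ k ∈ Finset.range n, φ (ξ k ω) • X k ω‖ ^ 2} := by
    ext ω
    rw [Set.mem_ofPred_eq, Set.mem_ofPred_eq, ← hsq, pow_le_pow_iff_left₀ hδ (norm_nonneg _)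
      two_ne_zero]
  rw [hset]
  refine (mul_meas_ge_le_integral_of_nonneg (ae_of_all _ fun ω => by positivity)
    ((integrable_norm_sq_sum hLp n).const_mul _) _).trans_eq ?_
  rw [integral_const_mul, integral_norm_sq_sum (D.iIndepFun_smul hφ) (D.identDistrib_smul hφ)
    (D.memLp_smul hφ hle) (D.integral_smul_coord hφ), inv_mul_cancel_left₀ hn'.ne',
    D.integral_norm_sq_smul hφ]

lemma integral_inner_sq (D : IsRandomDesign μ X ξ) (t : EuclideanSpace ℝ (Fin p)) :
    ∫ ω, (inner ℝ (X 0 ω) t : ℝ) ^ 2 ∂μ = ‖t‖ ^ 2 := by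
  have h : ∀ ω, (inner ℝ (X 0 ω) t : ℝ) ^ 2
      = ∑ j, ∑ k, t j * t k * (X 0 ω j * X 0 ω k) := fun ω => by
    rw [PiLp.inner_apply, sq, Finset.sum_mul_sum]
    refine Finset.sum_congr rfl fun j _ => Finset.sum_congr rfl fun k _ => ?_
    simp
    ring
  simp only [h]
  rw [integral_finsetSum _ fun j _ => integrable_finsetSum _ fun k _ =>
    (D.isIsotropic j k).1.const_mul _]
  rw [EuclideanSpace.real_norm_sq_eq]
  refine Finset.sum_congr rfl fun j _ => ?_
  rw [integral_finsetSum _ fun k _ => (D.isIsotropic j k).1.const_mul _]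
  simp [integral_const_mul, (D.isIsotropic _ _).2, sq]

lemma tendstoInDistribution_noise_smul [IsProbabilityMeasure μ] (D : IsRandomDesign μ X ξ) :
    TendstoInDistribution (fun (n : ℕ) ω => (√(n : ℝ))⁻¹ • ∑ k ∈ Finset.range n, ξ k ω • X k ω)
      atTop (fun z => z) (fun _ => μ) (stdGaussian (EuclideanSpace ℝ (Fin p))) := by
  have hX := D.measurable_covariate 0
  have hξ := D.measurable_noise 0
  have hid : Measurable fun s : ℝ => s := measurable_id
  refine tendstoInDistribution_inv_sqrt_smul_sum (D.iIndepFun_smul hid) (D.identDistrib_smul hid)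
    (fun t => ?_) fun t => ?_
  · have hint := (D.memLp_smul hid fun _ => le_rfl)
    have hcoord : ∀ j, MemLp (fun ω => (ξ 0 ω • X 0 ω) j) 2 μ := fun j =>
      (EuclideanSpace.proj (𝕜 := ℝ) j).comp_memLp' hint
    simp only [PiLp.inner_apply]
    rw [integral_finsetSum _ fun j _ => ((hcoord j).integrable (by norm_num)).inner_const (t j)]
    refine Finset.sum_eq_zero fun j _ => ?_
    simp only [RCLike.inner_apply, conj_trivial]
    rw [integral_const_mul, D.integral_smul_coord hid, mul_zero]
  · simp only [real_inner_smul_left, mul_pow]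
    rw [← D.integral_inner_sq t, ← one_mul (∫ ω, (inner ℝ (X 0 ω) t : ℝ) ^ 2 ∂μ),
      ← D.integral_noise_sq]
    exact (D.indepFun.symm.comp (φ := fun s => s ^ 2) (ψ := fun v => (inner ℝ v t : ℝ) ^ 2)
      (by fun_prop) (by fun_prop)).integral_fun_mul_eq_mul_integral
        (hξ.pow_const 2).aestronglyMeasurable
        (Measurable.aestronglyMeasurable (by simp only [Function.comp_def]; fun_prop))

/-! ### Data are typical with probability tending to one -/

/-- The constant of the envelope that holds with probability tending to one. -/
def envelopeBound (μ : Measure Ω) (X : ℕ → Ω → EuclideanSpace ℝ (Fin p)) (ξ : ℕ → Ω → ℝ) : ℝ :=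
  ∫ ω, envelope (X 0 ω) (ξ 0 ω) ∂μ + 1

lemma one_le_envelopeBound : 1 ≤ envelopeBound μ X ξ :=
  le_add_of_nonneg_left (integral_nonneg fun _ => zero_le_one.trans (one_le_envelope _ _))

/-- Applying the law of large numbers to the rank-one operators v ↦ ⟨X, v⟩ X in operator norm yields
the covariance bound for all directions at once. -/
lemma tendsto_measure_not_isTypical [IsProbabilityMeasure μ] (D : IsRandomDesign μ X ξ) {η : ℝ} (hη : 0 < η) :
    Tendsto (fun n : ℕ => μ.real {ω | ¬ IsTypical (fun i : Fin n => X i ω)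
      (fun i : Fin n => ξ i ω) (envelopeBound μ X ξ) η}) atTop (𝓝 0) := by
  have hX := D.measurable_covariate
  have hξ := D.measurable_noise
  -- the strong law of large numbers for the envelope
  have hqm : Measurable fun z : EuclideanSpace ℝ (Fin p) × ℝ => envelope z.1 z.2 := by
    unfold envelope; fun_prop
  have hq := strong_law_ae (μ := μ) (fun i ω => envelope (X i ω) (ξ i ω)) D.integrable_envelope
    (fun i j hij => (D.iIndepFun.indepFun hij).comp hqm hqm) fun i => (D.identDistrib i).comp hqm
  -- the strong law of large numbers for the empirical covariance operator
  have hRc : Continuous fun v : EuclideanSpace ℝ (Fin p) =>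
      (innerSL ℝ v).smulRight v := by fun_prop
  have hRm : Measurable fun z : EuclideanSpace ℝ (Fin p) × ℝ => (innerSL ℝ z.1).smulRight z.1 :=
    hRc.measurable.comp measurable_fst
  have hRint : Integrable (fun ω => (innerSL ℝ (X 0 ω)).smulRight (X 0 ω)) μ := by
    refine D.integrable_norm_sq.mono' (hRc.measurable.comp (hX 0)).aestronglyMeasurable
      (ae_of_all _ fun ω => ?_)
    rw [ContinuousLinearMap.norm_smulRight_apply, innerSL_apply_norm, sq]
  have hR := strong_law_ae (μ := μ) (fun i ω => (innerSL ℝ (X i ω)).smulRight (X i ω)) hRint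
    (fun i j hij => (D.iIndepFun.indepFun hij).comp hRm hRm) fun i => (D.identDistrib i).comp hRm
  have hRmean : ∫ ω, (innerSL ℝ (X 0 ω)).smulRight (X 0 ω) ∂μ
      = ContinuousLinearMap.id ℝ (EuclideanSpace ℝ (Fin p)) := by
    ext t j
    rw [ContinuousLinearMap.integral_apply hRint]
    refine ((EuclideanSpace.proj (𝕜 := ℝ) j).integral_comp_comm
      (hRint.apply_continuousLinearMap t)).symm.trans ?_
    change ∫ ω, ((innerSL ℝ (X 0 ω)).smulRight (X 0 ω) t) j ∂μ = t j
    have h : ∀ ω, ((innerSL ℝ (X 0 ω)).smulRight (X 0 ω) t) j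
        = ∑ k, t k * (X 0 ω k * X 0 ω j) := fun ω => by
      simp [PiLp.inner_apply, Finset.sum_mul, mul_assoc]
    simp only [h]
    rw [integral_finsetSum _ fun k _ => (D.isIsotropic k j).1.const_mul _]
    simp [integral_const_mul, (D.isIsotropic _ _).2]
  have hqM := tendstoInMeasure_of_tendsto_ae (fun n => by
    refine Measurable.aestronglyMeasurable ?_
    exact (Finset.measurable_fun_sum (Finset.range n) fun i _ =>
      hqm.comp ((hX i).prodMk (hξ i))).const_smul (n : ℝ)⁻¹) hq
  have hRM := tendstoInMeasure_of_tendsto_ae (fun n => by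
    refine Measurable.aestronglyMeasurable ?_
    exact (Finset.measurable_fun_sum (Finset.range n) fun i _ =>
      hRc.measurable.comp (hX i)).const_smul (n : ℝ)⁻¹) hR
  rw [tendstoInMeasure_iff_measureReal_norm] at hqM hRM
  have hlim := (hqM 1 one_pos).add (hRM η hη)
  rw [add_zero] at hlim
  refine tendsto_of_tendsto_of_tendsto_of_le_of_le' tendsto_const_nhds hlim
    (Eventually.of_forall fun n => measureReal_nonneg) ?_
  filter_upwards [eventually_gt_atTop 0] with n hn
  have hn' : (0 : ℝ) < n := by exact_mod_cast hn
  refine (measureReal_mono (fun ω hω => ?_)).trans (measureReal_union_le _ _)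
  by_contra hcon
  rw [Set.mem_union, not_or, Set.mem_ofPred_eq, Set.mem_ofPred_eq, not_le, not_le] at hcon
  obtain ⟨h1, h2⟩ := hcon
  refine hω ⟨?_, fun t => ?_⟩
  · rw [Fin.sum_univ_eq_sum_range (fun i => envelope (X i ω) (ξ i ω)) n]
    rw [Real.norm_eq_abs, smul_eq_mul] at h1
    have h3 := (lt_of_abs_lt h1).le
    rw [sub_le_iff_le_add, inv_mul_le_iff₀ hn'] at h3
    rwa [envelopeBound, add_comm]
  · rw [Fin.sum_univ_eq_sum_range (fun i => (inner ℝ (X i ω) t : ℝ) • X i ω) n]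
    rw [hRmean] at h2
    have h3 := ((n : ℝ)⁻¹ • ∑ i ∈ Finset.range n, (innerSL ℝ (X i ω)).smulRight (X i ω)
      - ContinuousLinearMap.id ℝ (EuclideanSpace ℝ (Fin p))).le_of_opNorm_le h2.le t
    have h4 : ∑ i ∈ Finset.range n, (inner ℝ (X i ω) t : ℝ) • X i ω - (n : ℝ) • t
        = (n : ℝ) • (((n : ℝ)⁻¹ • ∑ i ∈ Finset.range n, (innerSL ℝ (X i ω)).smulRight (X i ω)
          - ContinuousLinearMap.id ℝ (EuclideanSpace ℝ (Fin p))) t) := by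
      simp [smul_sub, smul_inv_smul₀ hn'.ne', _root_.sum_apply]
    rw [h4, norm_smul, Real.norm_of_nonneg hn'.le, mul_assoc]
    gcongr

end IsRandomDesign

/-! ### The score tends to the identity as τ → 0 -/

lemma abs_score_sub_self_le {τ : ℝ} (hτ : 0 ≤ τ) (s : ℝ) : |score τ s - s| ≤ |s| := by
  have h0 := Real.exp_pos (-(τ * s ^ 2) / 2)
  have h1 : Real.exp (-(τ * s ^ 2) / 2) ≤ 1 :=
    Real.exp_le_one_iff.mpr (by linarith [mul_nonneg hτ (sq_nonneg s)])
  rw [show score τ s - s = s * (Real.exp (-(τ * s ^ 2) / 2) - 1) by rw [score]; ring, abs_mul]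
  refine mul_le_of_le_one_right (abs_nonneg _) ?_
  rw [abs_le]
  constructor <;> linarith

lemma measurable_score (τ : ℝ) : Measurable (score τ) := by
  unfold score
  fun_prop

lemma tendsto_integral_score_sub_sq {ζ : Ω → ℝ} (hζm : Measurable ζ) (hζ : MemLp ζ 2 μ)
    {τ : ℕ → ℝ} (hτ0 : ∀ᶠ n in atTop, 0 ≤ τ n) (hτ : Tendsto τ atTop (𝓝 0)) :
    Tendsto (fun n => ∫ ω, (score (τ n) (ζ ω) - ζ ω) ^ 2 ∂μ) atTop (𝓝 0) := by
  have : Tendsto (fun n => ∫ ω, (score (τ n) (ζ ω) - ζ ω) ^ 2 ∂μ) atTop (𝓝 (∫ _, (0 : ℝ) ∂μ)) := by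
    refine tendsto_integral_filter_of_dominated_convergence (fun ω => ζ ω ^ 2) ?_ ?_
      hζ.integrable_sq ?_
    · exact Eventually.of_forall fun n =>
        ((((measurable_score _).comp hζm).sub hζm).pow_const 2).aestronglyMeasurable
    · filter_upwards [hτ0] with n hn
      refine ae_of_all _ fun ω => ?_
      rw [Real.norm_of_nonneg (sq_nonneg _)]
      exact sq_le_sq.2 (abs_score_sub_self_le hn _)
    · refine ae_of_all _ fun ω => ?_
      have hc : Continuous fun t : ℝ => (score t (ζ ω) - ζ ω) ^ 2 := by
        unfold score
        fun_prop
      have := (hc.tendsto 0).comp hτ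
      simpa [score, Function.comp_def] using this
  simpa using this

end WelschRegression
end

/-! ### Asymptotic linearity and conclusion -/

noncomputable section

namespace WelschRegression

variable {Ω : Type*} [MeasurableSpace Ω] {μ : Measure Ω} [IsProbabilityMeasure μ] {p : ℕ}
  {X : ℕ → Ω → EuclideanSpace ℝ (Fin p)} {ξ Y : ℕ → Ω → ℝ}

/-- The asymptotic linear representation of the outputs of the algorithm. -/
theorem IsRandomDesign.tendstoInMeasure_sub (D : IsRandomDesign μ X ξ)
    {βs : EuclideanSpace ℝ (Fin p)} (hY : ∀ i ω, Y i ω = inner ℝ (X i ω) βs + ξ i ω)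
    {τ : ℕ → ℝ} (hτ0 : ∀ᶠ n in atTop, 0 < τ n) (hτ : Tendsto τ atTop (𝓝 0))
    {c : ℝ} {β0 : EuclideanSpace ℝ (Fin p)} {βhat : ℕ → Ω → EuclideanSpace ℝ (Fin p)}
    (hβhat : Tendsto (fun n : ℕ => μ {ω | ¬ IsAlgorithmOutput (fun i : Fin n => X i ω)
      (fun i : Fin n => Y i ω) (τ n) c β0 (βhat n ω)}) atTop (𝓝 0)) :
    TendstoInMeasure μ ((fun (n : ℕ) ω => √(n : ℝ) • (βhat n ω - βs)) -
      fun (n : ℕ) ω => (√(n : ℝ))⁻¹ • ∑ k ∈ Finset.range n, ξ k ω • X k ω) atTop 0 := by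
  simp only [tendstoInMeasure_iff_measureReal_norm, Pi.zero_apply, sub_zero, Pi.sub_apply]
  intro δ hδ
  rw [Metric.tendsto_atTop']
  intro κ hκ
  -- choose the relative error of the linearization
  obtain ⟨ε, hε, hε1, hεκ⟩ : ∃ ε > 0, ε ≤ 1 / 2 ∧ ε ^ 2 * (16 * p) < δ ^ 2 * (κ / 4) := by
    have hc : Tendsto (fun ε : ℝ => ε ^ 2 * (16 * p)) (𝓝[>] 0) (𝓝 0) := by
      refine tendsto_nhdsWithin_of_tendsto_nhds ?_
      have : Continuous fun ε : ℝ => ε ^ 2 * (16 * p) := by fun_prop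
      simpa using this.tendsto 0
    have h1 := hc.eventually_lt_const (by positivity : 0 < δ ^ 2 * (κ / 4))
    have h2 : ∀ᶠ ε : ℝ in 𝓝[>] 0, ε ∈ Set.Ioc 0 (1 / 2) := Ioc_mem_nhdsGT (by norm_num)
    obtain ⟨ε, h, h'⟩ := (h1.and h2).exists
    exact ⟨ε, h'.1, h'.2, h⟩
  obtain ⟨τ₀, hτ₀, hlin⟩ := exists_forall_isAlgorithmOutput_norm_le
    (one_le_envelopeBound (μ := μ) (X := X) (ξ := ξ)) hε (hε1.trans (by norm_num)) βs β0
  have hout := ((ENNReal.tendsto_toReal ENNReal.zero_ne_top).comp hβhat).eventually_lt_const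
    (by positivity : (0 : ENNReal).toReal < κ / 4)
  have htyp := (D.tendsto_measure_not_isTypical (half_pos hε)).eventually_lt_const
    (by positivity : 0 < κ / 4)
  have hbias := ((tendsto_integral_score_sub_sq (D.measurable_noise 0) D.memLp_noise
    (hτ0.mono fun _ h => h.le) hτ).const_mul (p : ℝ)).eventually_lt_const
      (by rw [mul_zero]; positivity : (p : ℝ) * 0 < (δ / 4) ^ 2 * (κ / 4))
  have hall := (hout.and htyp).and (hbias.and ((hτ0.and (hτ.eventually_le_const hτ₀)).and
    (eventually_gt_atTop 0)))
  obtain ⟨N, hN⟩ := eventually_atTop.1 hall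
  refine ⟨N, fun n hnN => ?_⟩
  obtain ⟨⟨hout, htyp⟩, hbias, ⟨hτn, hτn'⟩, hn⟩ := hN n (le_of_lt hnN)
  have hn' : (0 : ℝ) < n := by exact_mod_cast hn
  rw [Real.dist_eq, sub_zero, abs_of_nonneg measureReal_nonneg]
  have hT := D.sq_mul_measureReal_le measurable_id (fun _ => le_rfl)
    (by positivity : 0 ≤ δ / (4 * ε)) hn
  have hR := D.sq_mul_measureReal_le (φ := fun s => score (τ n) s - s)
    ((measurable_score _).sub measurable_id) (abs_score_sub_self_le hτn.le)
    (by positivity : 0 ≤ δ / 4) hn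
  simp only [id_eq, D.integral_noise_sq, mul_one] at hT
  set A1 := {ω | ¬ IsAlgorithmOutput (fun i : Fin n => X i ω)
      (fun i : Fin n => Y i ω) (τ n) c β0 (βhat n ω)}
  set A2 := {ω | ¬ IsTypical (fun i : Fin n => X i ω)
      (fun i : Fin n => ξ i ω) (envelopeBound μ X ξ) (ε / 2)}
  set A3 := {ω | δ / (4 * ε) ≤ ‖(√(n : ℝ))⁻¹ • ∑ k ∈ Finset.range n, ξ k ω • X k ω‖}
  set A4 := {ω | δ / 4 ≤ ‖(√(n : ℝ))⁻¹ • ∑ k ∈ Finset.range n,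
      (score (τ n) (ξ k ω) - ξ k ω) • X k ω‖}
  have h3 : μ.real A3 < κ / 4 := by
    have h : (δ / (4 * ε)) ^ 2 * μ.real A3 < (δ / (4 * ε)) ^ 2 * (κ / 4) := by
      refine hT.trans_lt ?_
      rw [div_pow, div_mul_eq_mul_div, lt_div_iff₀ (by positivity)]
      linarith
    exact lt_of_mul_lt_mul_left h (by positivity)
  have h4 : μ.real A4 < κ / 4 := lt_of_mul_lt_mul_left (hR.trans_lt hbias) (by positivity)
  have hsub : {ω | δ ≤ ‖√(n : ℝ) • (βhat n ω - βs)
      - (√(n : ℝ))⁻¹ • ∑ k ∈ Finset.range n, ξ k ω • X k ω‖} ⊆ (A1 ∪ A2) ∪ (A3 ∪ A4) := by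
    intro ω hω
    by_contra hcon
    simp only [Set.mem_union, not_or, A1, A2, A3, A4, Set.mem_ofPred_eq, not_not, not_le] at hcon
    obtain ⟨⟨g1, g2⟩, g3, g4⟩ := hcon
    have hk := hlin n _ _ _ (τ n) c _ hn hτn hτn' (fun i : Fin n => hY i ω) g2 g1
    rw [Fin.sum_univ_eq_sum_range (fun i => score (τ n) (ξ i ω) • X i ω) n] at hk
    have hs : 0 < √(n : ℝ) := Real.sqrt_pos.2 hn'
    have hs2 : √(n : ℝ) * √(n : ℝ) = n := Real.mul_self_sqrt hn'.le
    set s := √(n : ℝ)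
    set h := βhat n ω - βs
    set T := ∑ k ∈ Finset.range n, ξ k ω • X k ω
    have hψ : ‖s • h - s⁻¹ • ∑ k ∈ Finset.range n, score (τ n) (ξ k ω) • X k ω‖
        ≤ ε * ‖s • h‖ := by
      have e : s • h - s⁻¹ • ∑ k ∈ Finset.range n, score (τ n) (ξ k ω) • X k ω
          = s⁻¹ • ((n : ℝ) • h - ∑ k ∈ Finset.range n, score (τ n) (ξ k ω) • X k ω) := by
        rw [smul_sub s⁻¹, smul_smul, ← hs2, inv_mul_cancel_left₀ hs.ne']
      rw [e, norm_smul, norm_smul, norm_inv, Real.norm_of_nonneg hs.le, inv_mul_le_iff₀ hs]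
      calc _ ≤ n * ε * ‖h‖ := hk
        _ = s * (ε * (s * ‖h‖)) := by rw [← hs2]; ring
    have hdec : s • h - s⁻¹ • T
        = (s • h - s⁻¹ • ∑ k ∈ Finset.range n, score (τ n) (ξ k ω) • X k ω)
          + s⁻¹ • ∑ k ∈ Finset.range n, (score (τ n) (ξ k ω) - ξ k ω) • X k ω := by
      simp only [sub_smul, Finset.sum_sub_distrib, smul_sub, T]
      abel
    have hD : ‖s • h - s⁻¹ • T‖ < ε * ‖s • h‖ + δ / 4 := by
      rw [hdec]
      exact (norm_add_le _ _).trans_lt (add_lt_add_of_le_of_lt hψ g4)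
    have hH : ‖s • h‖ ≤ ‖s • h - s⁻¹ • T‖ + ‖s⁻¹ • T‖ := by
      simpa using norm_add_le (s • h - s⁻¹ • T) (s⁻¹ • T)
    have hεT : ε * ‖s⁻¹ • T‖ ≤ δ / 4 := by
      rw [lt_div_iff₀ (by positivity)] at g3
      linarith
    have hω' : δ ≤ ‖s • h - s⁻¹ • T‖ := hω
    -- With D = ‖s • h - s⁻¹ • T‖, the bounds give D < εD + δ/4 + δ/4 ≤ D/2 + δ/2, so D < δ.
    nlinarith [mul_le_mul_of_nonneg_left hH hε.le,
      mul_le_mul_of_nonneg_right hε1 (norm_nonneg (s • h - s⁻¹ • T))]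
  calc _ ≤ μ.real ((A1 ∪ A2) ∪ (A3 ∪ A4)) := measureReal_mono hsub
    _ ≤ (μ.real A1 + μ.real A2) + (μ.real A3 + μ.real A4) :=
        (measureReal_union_le _ _).trans
          (add_le_add (measureReal_union_le _ _) (measureReal_union_le _ _))
    _ < κ := by
        have h1 : μ.real A1 < κ / 4 := hout
        linarith

end WelschRegression
end

theorem theorem4 {Ω : Type*} [MeasurableSpace Ω] (μ : Measure Ω) [IsProbabilityMeasure μ]
    {p : ℕ} (βstar : EuclideanSpace ℝ (Fin p))
    -- covariates, noise and uncontaminated responses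
    (X : ℕ → Ω → EuclideanSpace ℝ (Fin p)) (ξ : ℕ → Ω → ℝ) (Y : ℕ → Ω → ℝ)
    (hY : ∀ i ω, Y i ω = inner ℝ (X i ω) βstar + ξ i ω)
    (hXmeas : ∀ i, Measurable (X i)) (hξmeas : ∀ i, Measurable (ξ i))
    -- the pairs `(X_i, ξ_i)` are i.i.d., and `ξ_i` is independent of `X_i`
    (hindep : iIndepFun (fun i ω => (X i ω, ξ i ω)) μ)
    (hident : ∀ i, IdentDistrib (fun ω => (X i ω, ξ i ω)) (fun ω => (X 0 ω, ξ 0 ω)) μ μ)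
    (hXξ : ∀ i, IndepFun (X i) (ξ i) μ)
    -- the covariates are centered, isotropic and `1`-sub-Gaussian
    (hXmean : ∫ ω, X 0 ω ∂μ = 0)
    (hXiso : WelschRegression.IsIsotropic μ (X 0))
    (hXsub : WelschRegression.IsOneSubGaussian μ (X 0))
    -- the noise is centered with unit variance
    (hξL2 : MemLp (ξ 0) 2 μ) (hξmean : ∫ ω, ξ 0 ω ∂μ = 0) (hξvar : ∫ ω, ξ 0 ω ^ 2 ∂μ = 1)
    -- `τ_n = u_n / n`, where `u_n` tends to infinity, more slowly than `n`
    (u : ℕ → ℝ) (hu : Tendsto u atTop atTop)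
    (hu_slow : Tendsto (fun n : ℕ => u n / (n : ℝ)) atTop (𝓝 0))
    -- exit threshold and starting point of the algorithm
    (c : ℝ) (β0 : EuclideanSpace ℝ (Fin p))
    -- `βhat n` is, with probability tending to one, an output of the algorithm on the first `n`
    -- observations
    (βhat : ℕ → Ω → EuclideanSpace ℝ (Fin p)) (hβmeas : ∀ n, Measurable (βhat n))
    (hβhat : Tendsto
      (fun n : ℕ => μ {ω | ¬ WelschRegression.IsAlgorithmOutput
        (fun i : Fin n => X i ω) (fun i : Fin n => Y i ω) (u n / (n : ℝ)) c β0 (βhat n ω)})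
      atTop (𝓝 0)) :
    TendstoInDistribution (fun (n : ℕ) ω => Real.sqrt (n : ℝ) • (βhat n ω - βstar)) atTop
      (fun z => z) (fun _ => μ) (stdGaussian (EuclideanSpace ℝ (Fin p))) := by
  have D : WelschRegression.IsRandomDesign μ X ξ :=
    ⟨hXmeas, hξmeas, hindep, hident, hXξ 0, hXmean, hXiso, hXsub, hξL2, hξvar⟩
  have hτ0 : ∀ᶠ n : ℕ in atTop, 0 < u n / (n : ℝ) := by
    filter_upwards [hu.eventually_gt_atTop 0, eventually_gt_atTop 0] with n h1 h2
    exact div_pos h1 (by exact_mod_cast h2)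
  -- Slutsky's lemma: a difference vanishing in probability does not change the limit law.
  exact tendstoInDistribution_of_tendstoInMeasure_sub _ _ D.tendstoInDistribution_noise_smul
    (D.tendstoInMeasure_sub hY hτ0 hu_slow hβhat)
    fun n => (((hβmeas n).sub_const βstar).const_smul (√(n : ℝ))).aemeasurable
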